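/- Let $n\ge 1$, $\hbar>0$, $h=2\pi\hbar$, and let $F$ be the unitary Fourier transform on $L^2(\mathbb{R}^n)$ given on Schwartz functions by $F\psi(p)=\left(\frac{1}{2\pi\hbar}\right)^{n/2}\int_{\mathbb{R}^n} e^{-\frac{i}{\hbar}p\cdot x}\psi(x)\,dx$. Let $A,B$ be real symmetric positive definite $n\times n$ matrices and write $Ax^2=x^TAx$, $Bp^2=p^TBp$. Let $\psi\in L^2(\mathbb{R}^n)$, $\psi\neq 0$, and assume that there are constants $C_A,C_B$ such that $$|\psi(x)|\le C_A\,e^{-\frac{1}{2\hbar}Ax^2}\quad\text{and}\quad |F\psi(p)|\le C_B\,e^{-\frac{1}{2\hbar}Bp^2}$$ for almost every $x\in\mathbb{R}^n$ and almost every $p\in\mathbb{R}^n$. Then the Wigner ellipsoid $\mathcal{W}=\{(x,p)\in\mathbb{R}^{2n}: Ax^2+Bp^2\le\hbar\}$ satisfies $$c(\mathcal{W})\ge \tfrac12 h$$ for every symplectic capacity $c$ on $\mathbb{R}^{2n}=\mathbb{R}^n\times\mathbb{R}^n$ with the symplectic form $\sigma((x,p),(x',p'))=p\cdot x'-p'\cdot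 x$. Here a symplectic capacity is a map $c$ from the subsets of $\mathbb{R}^{2n}$ to $[0,\infty]$ such that: $c(\Omega)\le c(\Omega')$ if $\Omega\subset\Omega'$; $c(f(\Omega))=c(\Omega)$ for every $C^\infty$ symplectomorphism $f$ from an open neighbourhood of $\Omega$ onto an open subset of $\mathbb{R}^{2n}$; $c(\lambda\Omega)=\lambda^2c(\Omega)$ for $\lambda\in\mathbb{R}$ (with $0\cdot\infty=0$); and $c(\{|z|\le R\})=c(\{x_j^2+p_j^2\le R^2\})=\pi R^2$ for all $R>0$ and $1\le j\le n$. -/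

import Mathlib

open MeasureTheory
open scoped ENNReal FourierTransform SchwartzMap ContDiff

noncomputable section

/-- The configuration space `ℝⁿ` with its Euclidean norm. -/
abbrev ConfigSpace (n : ℕ) : Type := EuclideanSpace ℝ (Fin n)

/-- The phase space `ℝ²ⁿ = ℝⁿ × ℝⁿ` of pairs `z = (x, p)`. -/
abbrev PhaseSpace (n : ℕ) : Type := ConfigSpace n × ConfigSpace n

/-- The `ħ`-dependent Fourier transform of an element of `L²(ℝⁿ)`, as a function determined up to
null sets: the rescaling `Fψ(p) = (1 / 2πħ)^{n/2} (𝓕ψ)(p / 2πħ)` of the unitary operator `𝓕` on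
`L²(ℝⁿ)` that is given on Schwartz functions by `(𝓕ψ)(ξ) = ∫ e^{-2πi ξ·x} ψ(x) dx`. -/
def hbarFourier {n : ℕ} (ħ : ℝ) (ψ : Lp (α := ConfigSpace n) ℂ 2) (p : ConfigSpace n) : ℂ :=
  (((1 / (2 * Real.pi * ħ)) ^ ((n : ℝ) / 2) : ℝ) : ℂ) * (𝓕 ψ) ((1 / (2 * Real.pi * ħ)) • p)

/-- On Schwartz functions, `hbarFourier` is the usual integral
`Fψ(p) = (1 / 2πħ)^{n/2} ∫ e^{-(i/ħ) p·x} ψ(x) dx`. -/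
theorem hbarFourier_schwartz {n : ℕ} {ħ : ℝ} (hħ : 0 < ħ) (φ : 𝓢(ConfigSpace n, ℂ)) :
    ∀ᵐ p : ConfigSpace n, hbarFourier ħ (φ.toLp 2) p =
      (((1 / (2 * Real.pi * ħ)) ^ ((n : ℝ) / 2) : ℝ) : ℂ) *
        ∫ x, Complex.exp (-(Complex.I / (ħ : ℂ)) * ((inner ℝ p x : ℝ) : ℂ)) * φ x := by
  have ha : (1 / (2 * Real.pi * ħ)) ≠ 0 := by positivity
  have h1 : ∀ᵐ q : ConfigSpace n, (𝓕 (φ.toLp 2) : Lp (α := ConfigSpace n) ℂ 2) q = (𝓕 φ) q := by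
    rw [SchwartzMap.toLp_fourier_eq]
    exact SchwartzMap.coeFn_toLp _ _ _
  have h2 : Measure.QuasiMeasurePreserving
      (fun p : ConfigSpace n => (1 / (2 * Real.pi * ħ)) • p) volume volume :=
    ⟨by fun_prop, by
      rw [Measure.map_addHaar_smul volume ha]
      exact Measure.smul_absolutelyContinuous⟩
  filter_upwards [h2.ae h1] with p hp
  rw [hbarFourier, hp, SchwartzMap.fourier_coe, Real.fourier_eq']
  congr 1
  refine integral_congr_ae (Filter.Eventually.of_forall fun x => ?_)
  simp only [smul_eq_mul, inner_smul_right]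
  congr 2
  rw [real_inner_comm]
  have : (ħ : ℂ) ≠ 0 := by exact_mod_cast hħ.ne'
  have : (Real.pi : ℂ) ≠ 0 := by exact_mod_cast Real.pi_ne_zero
  push_cast
  field_simp

/-- The quadratic form `Mx² = Mx · x = xᵀ M x` of a matrix `M`. -/
def quadForm {n : ℕ} (M : Matrix (Fin n) (Fin n) ℝ) (x : ConfigSpace n) : ℝ :=
  x.ofLp ⬝ᵥ (M.mulVec x.ofLp)

/-- The Wigner ellipsoid `Ax² + Bp² ≤ ħ` in phase space. -/
def wignerEllipsoid {n : ℕ} (ħ : ℝ) (A B : Matrix (Fin n) (Fin n) ℝ) : Set (PhaseSpace n) :=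
  {z | quadForm A z.1 + quadForm B z.2 ≤ ħ}

/-- The standard symplectic form `σ(z, z') = p · x' - p' · x` for `z = (x, p)`, `z' = (x', p')`. -/
def symplecticForm {n : ℕ} (z z' : PhaseSpace n) : ℝ :=
  inner ℝ z.2 z'.1 - inner ℝ z'.2 z.1

/-- `f` is a symplectomorphism from the open set `f.source` onto the open set `f.target`: a smooth
diffeomorphism whose derivative preserves the symplectic form at every point of `f.source`. -/
structure IsSymplectomorphism {n : ℕ} (f : OpenPartialHomeomorph (PhaseSpace n) (PhaseSpace n)) :
    Prop where
  contDiffOn : ContDiffOn ℝ ∞ f f.source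
  contDiffOn_symm : ContDiffOn ℝ ∞ f.symm f.target
  symplectic : ∀ z ∈ f.source, ∀ v w : PhaseSpace n,
    symplecticForm (fderiv ℝ f z v) (fderiv ℝ f z w) = symplecticForm v w

/-- The closed Euclidean ball `|z| ≤ R` in phase space (for `R ≥ 0`). -/
def phaseBall (n : ℕ) (R : ℝ) : Set (PhaseSpace n) :=
  {z | ‖z.1‖ ^ 2 + ‖z.2‖ ^ 2 ≤ R ^ 2}

/-- The symplectic cylinder `Z_j(R) : x_j² + p_j² ≤ R²`. -/
def phaseCylinder {n : ℕ} (j : Fin n) (R : ℝ) : Set (PhaseSpace n) :=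
  {z | z.1 j ^ 2 + z.2 j ^ 2 ≤ R ^ 2}

/-- `c` is a symplectic capacity on `(ℝ²ⁿ, σ)`: it assigns to every subset of phase space a number
in `[0, ∞]`, and is monotone, invariant under every symplectomorphism defined in a neighbourhood of
the set, conformal of degree two, and normalized on balls and symplectic cylinders. -/
structure IsSymplecticCapacity {n : ℕ} (c : Set (PhaseSpace n) → ℝ≥0∞) : Prop where
  mono : ∀ Ω Ω' : Set (PhaseSpace n), Ω ⊆ Ω' → c Ω ≤ c Ω'
  invariant : ∀ (Ω : Set (PhaseSpace n))
    (f : OpenPartialHomeomorph (PhaseSpace n) (PhaseSpace n)),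
    IsSymplectomorphism f → Ω ⊆ f.source → c (f '' Ω) = c Ω
  conformal : ∀ (r : ℝ) (Ω : Set (PhaseSpace n)),
    c ((fun z => r • z) '' Ω) = ENNReal.ofReal (r ^ 2) * c Ω
  ball : ∀ R : ℝ, 0 < R → c (phaseBall n R) = ENNReal.ofReal (Real.pi * R ^ 2)
  cylinder : ∀ (j : Fin n) (R : ℝ), 0 < R →
    c (phaseCylinder j R) = ENNReal.ofReal (Real.pi * R ^ 2)

end

/-! Write `Ax² = ‖Tx‖²` and `Bp² = ‖Up‖²` with `T`, `U` invertible. The linear symplectic map `(x,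
p) ↦ (T⁻¹x, T*p)` turns `Ax² + Bp²` into `‖x‖² + ‖UT*p‖²`, so it carries the ball of radius `√ħ`
into the Wigner ellipsoid as soon as `‖UT*p‖ ≤ ‖p‖` for all `p`. The capacity is then at least that
of the ball, `πħ = h/2`.

The inequality `‖UT*y‖ ≤ ‖y‖` is Hardy's uncertainty principle in the direction `y`. The Gaussian
bound on `ψ` extends `t ↦ 𝓕ψ(ξ + tT*y)` to an entire function of size at most `C exp(a (Im z)²)`,
with `a` proportional to `‖y‖²`. If the inequality failed, the bound on `𝓕ψ` would make this
function decay on the real line like `exp(-bt²)` with `b > a`; Phragmén–Lindelöf and Liouville then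
force it to vanish. As `ξ` is arbitrary, `𝓕ψ = 0`, contradicting `ψ ≠ 0`. -/

/-! ### Entire functions of order two -/

/-- Phragmén–Lindelöf for functions of order two in a sector of opening less than `π / 2`. -/
theorem norm_le_of_norm_le_on_sector_boundary {f : ℂ → ℂ} (hf : Differentiable ℂ f) {C K D θ : ℝ}
    (hθ : 0 < θ) (hθ' : θ < Real.pi / 2) (hD : 0 ≤ D) (hK : 0 ≤ K)
    (hgrowth : ∀ z, ‖f z‖ ≤ D * Real.exp (K * ‖z‖ ^ 2))
    (h0 : ∀ z : ℂ, z ≠ 0 → z.arg = 0 → ‖f z‖ ≤ C) (h1 : ∀ z : ℂ, z ≠ 0 → z.arg = θ → ‖f z‖ ≤ C)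
    {z : ℂ} (hz : z ≠ 0) (hz0 : 0 ≤ z.arg) (hz1 : z.arg ≤ θ) : ‖f z‖ ≤ C := by
  have hπ := Real.pi_pos
  have harg : ∀ w : ℂ, w.im ∈ Set.Icc 0 θ → (Complex.exp w).arg = w.im := fun w hw => by
    rw [Complex.arg_exp, toIocMod_eq_self]
    constructor <;> linarith [hw.1, hw.2]
  have key : ‖(f ∘ Complex.exp) (Complex.log z)‖ ≤ C := by
    -- The exponential maps the strip `0 ≤ Im w ≤ θ` to the sector. Order two becomes growth `exp(K
    -- e^{2|Re w|})`, admissible because `2 < π/θ`.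
    refine PhragmenLindelof.horizontal_strip (a := 0) (b := θ)
      (hf.comp Complex.differentiable_exp).diffContOnCl ⟨2, ?_, K, ?_⟩ ?_ ?_ ?_ ?_
    · rw [sub_zero, lt_div_iff₀ hθ]; linarith
    · refine Asymptotics.IsBigO.of_bound D (Filter.Eventually.of_forall fun w => ?_)
      refine (hgrowth _).trans ?_
      rw [Real.norm_of_nonneg (Real.exp_pos _).le, Complex.norm_exp, ← Real.exp_nat_mul]
      have : ((2 : ℕ) : ℝ) * w.re ≤ 2 * |w.re| := by push_cast; linarith [le_abs_self w.re]
      gcongr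
    · exact fun w hw => h0 _ (Complex.exp_ne_zero _)
        (by rw [harg w (by rw [hw]; exact ⟨le_rfl, hθ.le⟩), hw])
    · exact fun w hw => h1 _ (Complex.exp_ne_zero _)
        (by rw [harg w (by rw [hw]; exact ⟨hθ.le, le_rfl⟩), hw])
    · rwa [Complex.log_im]
    · rwa [Complex.log_im]
  simpa [Complex.exp_log hz] using key

/-- An entire function of order two that is bounded on the real line and on a double cone around
the imaginary axis is bounded. -/
theorem norm_le_of_norm_le_on_cone {f : ℂ → ℂ} (hf : Differentiable ℂ f) {C K D κ : ℝ}
    (hκ : 0 < κ) (hκ' : κ < 1) (hD : 0 ≤ D) (hK : 0 ≤ K)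
    (hgrowth : ∀ z, ‖f z‖ ≤ D * Real.exp (K * ‖z‖ ^ 2))
    (hreal : ∀ t : ℝ, ‖f t‖ ≤ C) (hcone : ∀ z : ℂ, z.re ^ 2 ≤ κ * ‖z‖ ^ 2 → ‖f z‖ ≤ C) (z : ℂ) :
    ‖f z‖ ≤ C := by
  wlog him : 0 ≤ z.im generalizing f z
  · have := this (f := fun z => f (-z)) (by fun_prop) (fun z => by simpa using hgrowth (-z))
      (fun t => by simpa using hreal (-t)) (fun z hz => hcone (-z) (by simpa using hz)) (-z)
      (by simpa using (not_le.1 him).le)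
    simpa using this
  wlog hre : 0 ≤ z.re generalizing f z
  · have := this (f := fun z => star (f (-star z)))
      (by
        have h1 : Differentiable ℂ fun z => f (-z) := by fun_prop
        have h2 := fun z => (h1 (star z)).star_star
        intro z
        simpa [Function.comp_def] using h2 z)
      (fun z => by simpa using hgrowth (-star z))
      (fun t => by simpa using hreal (-t))
      (fun z hz => by simpa using hcone (-star z) (by simpa using hz))
      (-star z) (by simpa using him) (by simpa using (not_le.1 hre).le)
    simpa using this
  by_cases hz : z.re ^ 2 ≤ κ * ‖z‖ ^ 2
  · exact hcone z hz
  have hz0 : z ≠ 0 := by rintro rfl; simp at hz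
  have hzpos : 0 < ‖z‖ := norm_pos_iff.2 hz0
  have hs : √κ < 1 := by rw [Real.sqrt_lt' one_pos]; simpa using hκ'
  have hs0 : 0 < √κ := Real.sqrt_pos.2 hκ
  -- After the reflections `z` lies in the first quadrant, outside the cone. The ray at angle
  -- `arccos √κ` is the edge of the cone, so both sides of the sector carry the bound.
  refine norm_le_of_norm_le_on_sector_boundary hf (θ := Real.arccos √κ) (by rwa [Real.arccos_pos])
    (by rwa [Real.arccos_lt_pi_div_two]) hD hK hgrowth ?_ ?_ hz0 (Complex.arg_nonneg_iff.2 him) ?_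
  · intro w _ hw
    rw [← Complex.norm_mul_exp_arg_mul_I w, hw]
    simpa using hreal ‖w‖
  · intro w hw0 hw
    refine hcone w ?_
    have := Complex.cos_arg hw0
    rw [hw, Real.cos_arccos (by linarith) hs.le, eq_div_iff (norm_ne_zero_iff.2 hw0)] at this
    rw [← this, mul_pow, Real.sq_sqrt hκ.le]
  · rw [← Real.arccos_cos (Complex.arg_nonneg_iff.2 him) (Complex.arg_le_pi z)]
    refine Real.antitone_arccos ?_
    rw [Complex.cos_arg hz0, le_div_iff₀ hzpos]
    refine abs_le_of_sq_le_sq' ?_ hre |>.2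
    rw [mul_pow, Real.sq_sqrt hκ.le]
    exact (not_le.1 hz).le

/-- The one-variable form of Hardy's uncertainty principle: an entire function that grows at most
like `exp (a (Im z)²)` and decays on the real line like `exp (-b t²)` with `a < b` vanishes. -/
theorem eq_zero_of_gaussian_bounds {g : ℂ → ℂ} (hg : Differentiable ℂ g) {a b C D : ℝ}
    (ha : 0 < a) (hab : a < b) (himag : ∀ z : ℂ, ‖g z‖ ≤ C * Real.exp (a * z.im ^ 2))
    (hreal : ∀ t : ℝ, ‖g t‖ ≤ D * Real.exp (-b * t ^ 2)) : g = 0 := by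
  have hC : 0 ≤ C := by simpa using (norm_nonneg _).trans (himag 0)
  have hD : 0 ≤ D := by simpa using (norm_nonneg _).trans (hreal 0)
  set f : ℂ → ℂ := fun z => g z * Complex.exp (b * z ^ 2) with hfdef
  have hf : Differentiable ℂ f := by fun_prop
  have hre : ∀ z : ℂ, ((b : ℂ) * z ^ 2).re = b * (z.re ^ 2 - z.im ^ 2) := fun z => by
    simp [pow_two]
  have hbound : ∀ z : ℂ, ‖f z‖ ≤ C * Real.exp (b * z.re ^ 2 - (b - a) * z.im ^ 2) := fun z => by
    rw [hfdef, norm_mul, Complex.norm_exp, hre]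
    refine (mul_le_mul_of_nonneg_right (himag z) (Real.exp_pos _).le).trans_eq ?_
    rw [mul_assoc, ← Real.exp_add]
    ring_nf
  have hnorm : ∀ z : ℂ, ‖z‖ ^ 2 = z.re ^ 2 + z.im ^ 2 := fun z => by
    rw [Complex.sq_norm, Complex.normSq_apply]; ring
  have hbdd : ∀ z, ‖f z‖ ≤ max C D := by
    -- This `κ` makes `(Re z)² ≤ κ‖z‖²` equivalent to `b (Re z)² ≤ (b - a) (Im z)²`, i.e. to a
    -- nonpositive exponent in `hbound`.
    refine norm_le_of_norm_le_on_cone hf (κ := (b - a) / (2 * b - a)) (K := b) (D := C)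
      (div_pos (by linarith) (by linarith)) ((div_lt_one (by linarith)).2 (by linarith)) hC
      (by linarith) ?_ ?_ ?_
    · intro z
      refine (hbound z).trans ?_
      gcongr
      rw [hnorm]
      nlinarith [sq_nonneg z.im]
    · intro t
      refine le_trans ?_ (le_max_right _ _)
      rw [hfdef, norm_mul, Complex.norm_exp, hre]
      refine (mul_le_mul_of_nonneg_right (hreal t) (Real.exp_pos _).le).trans_eq ?_
      rw [mul_assoc, ← Real.exp_add]
      simp
    · intro z hz
      refine le_trans ?_ (le_max_left _ _)
      refine (hbound z).trans (mul_le_of_le_one_right hC (Real.exp_le_one_iff.2 ?_))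
      rw [hnorm, div_mul_eq_mul_div, le_div_iff₀ (by linarith)] at hz
      nlinarith
  have hconst : ∀ z w, f z = f w := fun z w =>
    hf.apply_eq_apply_of_bounded (Metric.isBounded_iff_subset_closedBall 0 |>.2
      ⟨max C D, by rintro _ ⟨z, rfl⟩; simpa using hbdd z⟩) z w
  have hzero : ∀ z, f z = 0 := by
    intro z
    rw [← norm_le_zero_iff]
    -- The constant is zero because `f` decays along the imaginary axis.
    have hlim : Filter.Tendsto (fun y : ℝ => C * Real.exp (-((b - a) * y ^ 2))) Filter.atTop
        (nhds (C * 0)) :=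
      (Real.tendsto_exp_neg_atTop_nhds_zero.comp
        ((Filter.tendsto_pow_atTop two_ne_zero).const_mul_atTop (sub_pos.2 hab))).const_mul C
    rw [mul_zero] at hlim
    refine ge_of_tendsto' hlim fun y => ?_
    rw [hconst z (y * Complex.I)]
    simpa using hbound (y * Complex.I)
  funext z
  simpa [hfdef] using hzero z

/-! ### Fourier and Laplace integrals -/

/-- The `L²` Fourier transform of an integrable function is given by the Fourier integral. -/
theorem MeasureTheory.Lp.fourier_ae_eq_fourierIntegral {E : Type*} [NormedAddCommGroup E]
    [InnerProductSpace ℝ E] [FiniteDimensional ℝ E] [MeasurableSpace E] [BorelSpace E]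
    (ψ : Lp (α := E) ℂ 2) (hψ : Integrable ψ) :
    (𝓕 ψ : Lp (α := E) ℂ 2) =ᵐ[volume] 𝓕 (ψ : E → ℂ) := by
  have hcont : Continuous (𝓕 (ψ : E → ℂ)) :=
    VectorFourier.fourierIntegral_continuous Real.continuous_fourierChar continuous_inner hψ
  -- Both sides are tested against smooth compactly supported functions; in each pairing the
  -- transform moves onto the test function.
  refine ae_eq_of_integral_contDiff_smul_eq
    ((Lp.memLp _).locallyIntegrable (by norm_num)) hcont.locallyIntegrable fun φ hφ hφc => ?_
  have hφ' : ContDiff ℝ ∞ fun x => (φ x : ℂ) := Complex.ofRealCLM.contDiff.comp hφ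
  have hφc' : HasCompactSupport fun x => (φ x : ℂ) := hφc.comp_left (g := fun t : ℝ => (t : ℂ)) rfl
  set Φ : 𝓢(E, ℂ) := hφc'.toSchwartzMap hφ'
  have hΦ : ∀ x, Φ x = φ x := fun x => rfl
  have h1 := congrArg (fun T => T Φ) (Lp.fourier_toTemperedDistribution_eq ψ)
  simp only [TemperedDistribution.fourier_apply, Lp.toTemperedDistribution_apply] at h1
  have h2 := VectorFourier.integral_fourierIntegral_smul_eq_flip (μ := volume) (ν := volume)
    (L := innerₗ E) Real.continuous_fourierChar continuous_inner hψ Φ.integrable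
  have h3 : ∀ ξ, VectorFourier.fourierIntegral Real.fourierChar volume (innerₗ E) ψ ξ =
      𝓕 (ψ : E → ℂ) ξ := fun ξ => rfl
  have h4 : ∀ x, VectorFourier.fourierIntegral Real.fourierChar volume (innerₗ E).flip Φ x =
      (𝓕 Φ) x := fun x => by rw [flip_innerₗ, SchwartzMap.fourier_coe]; rfl
  simp only [h3, h4, hΦ] at h2
  simp only [hΦ, smul_eq_mul] at h1 h2
  simp only [Complex.real_smul]
  rw [← h1]
  simp only [mul_comm (φ _ : ℂ), h2]
  simp only [mul_comm]

/-- The bilateral Laplace transform along a real-valued function is entire as soon as all its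
exponential moments exist. -/
theorem differentiable_integral_cexp_mul {α : Type*} [MeasurableSpace α] {μ : Measure α}
    {h : α → ℂ} {l : α → ℝ} (hh : AEStronglyMeasurable h μ) (hl : AEStronglyMeasurable l μ)
    (hint : ∀ τ : ℝ, Integrable (fun x => Real.exp (τ * l x) * ‖h x‖) μ) :
    Differentiable ℂ fun z : ℂ => ∫ x, Complex.exp (z * l x) * h x ∂μ := by
  intro z₀
  have hl' : AEStronglyMeasurable (fun x => (l x : ℂ)) μ :=
    Complex.continuous_ofReal.comp_aestronglyMeasurable hl
  have hmeas : ∀ z : ℂ, AEStronglyMeasurable (fun x => Complex.exp (z * l x) * h x) μ := fun z =>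
    (Complex.continuous_exp.comp_aestronglyMeasurable (hl'.const_mul z)).mul hh
  -- One unit pays for the radius of the ball, the other for the factor `|l| ≤ exp |l|` from the
  -- derivative.
  set k : ℝ := |z₀.re| + 2 with hk
  refine (hasDerivAt_integral_of_dominated_loc_of_deriv_le (Metric.ball_mem_nhds z₀ one_pos)
    (F' := fun z x => Complex.exp (z * l x) * l x * h x)
    (bound := fun x => Real.exp (k * l x) * ‖h x‖ + Real.exp (-k * l x) * ‖h x‖)
    (Filter.Eventually.of_forall hmeas) ?_ ?_ ?_ ((hint k).add (hint (-k))) ?_).2.differentiableAt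
  · refine (hint z₀.re).mono' (hmeas z₀) (Filter.Eventually.of_forall fun x => ?_)
    simp [Complex.norm_exp]
  · exact ((Complex.continuous_exp.comp_aestronglyMeasurable (hl'.const_mul z₀)).mul hl').mul hh
  · refine Filter.Eventually.of_forall fun x z hz => ?_
    rw [norm_mul, norm_mul, Complex.norm_exp, ← add_mul]
    refine mul_le_mul_of_nonneg_right ?_ (norm_nonneg _)
    have hzre : |z.re| ≤ |z₀.re| + 1 := by
      have h1 := (Complex.abs_re_le_norm (z - z₀)).trans (mem_ball_iff_norm.1 hz).le
      have h2 := abs_sub_abs_le_abs_sub z.re z₀.re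
      rw [Complex.sub_re] at h1
      linarith
    have h3 : (z * l x).re ≤ (|z₀.re| + 1) * |l x| := by
      rw [Complex.re_mul_ofReal]
      refine (le_abs_self _).trans ?_
      rw [abs_mul]
      gcongr
    have h4 : ‖(l x : ℂ)‖ ≤ Real.exp |l x| := by
      rw [Complex.norm_real, Real.norm_eq_abs]
      linarith [Real.add_one_le_exp |l x|]
    calc Real.exp (z * l x).re * ‖(l x : ℂ)‖
        ≤ Real.exp ((|z₀.re| + 1) * |l x|) * Real.exp |l x| := by gcongr
      _ = Real.exp (k * |l x|) := by rw [← Real.exp_add, hk]; ring_nf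
      _ ≤ Real.exp (k * l x) + Real.exp (-k * l x) := by
        rcases abs_choice (l x) with h | h <;> rw [h]
        · linarith [Real.exp_pos (-k * l x)]
        · rw [mul_neg, ← neg_mul]
          linarith [Real.exp_pos (k * l x)]
  · refine Filter.Eventually.of_forall fun x z _ => ?_
    simpa using (((hasDerivAt_id z).mul_const (l x : ℂ)).cexp.mul_const (h x))

/-! ### Gaussian integrals and Hardy's uncertainty principle -/

section Gaussian

/-- Completing the square: the linear weight only translates the Gaussian, so its moments follow
from translation invariance. -/
theorem exp_inner_mul_exp_neg_mul_sq_norm_map {E : Type*} [NormedAddCommGroup E]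
    [InnerProductSpace ℝ E] (T : E ≃L[ℝ] E) {s : ℝ} (hs : 0 < s) (y : E) (τ : ℝ) (x : E) :
    Real.exp (τ * inner ℝ (T x) y) * Real.exp (-s * ‖T x‖ ^ 2) =
      Real.exp (τ ^ 2 * ‖y‖ ^ 2 / (4 * s)) *
        Real.exp (-s * ‖T (x - (τ / (2 * s)) • T.symm y)‖ ^ 2) := by
  rw [← Real.exp_add, ← Real.exp_add, map_sub, map_smul, T.apply_symm_apply, norm_sub_sq_real,
    inner_smul_right, norm_smul, mul_pow, Real.norm_eq_abs, sq_abs]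
  congr 1
  field_simp
  ring

variable {E : Type*} [NormedAddCommGroup E] [InnerProductSpace ℝ E] [FiniteDimensional ℝ E]
  [MeasurableSpace E] [BorelSpace E]

theorem integrable_exp_neg_mul_sq_norm_map (T : E ≃L[ℝ] E) {s : ℝ} (hs : 0 < s) :
    Integrable fun x => Real.exp (-s * ‖T x‖ ^ 2) := by
  cases subsingleton_or_nontrivial E
  · exact Integrable.of_finite
  have hN : 0 < ‖(T.symm : E →L[ℝ] E)‖ := T.symm.norm_pos
  have hb : 0 < s / ‖(T.symm : E →L[ℝ] E)‖ ^ 2 := by positivity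
  have h1 := (GaussianFourier.integrable_cexp_neg_mul_sq_norm_add (V := E)
    (b := ((s / ‖(T.symm : E →L[ℝ] E)‖ ^ 2 : ℝ) : ℂ)) (by rwa [Complex.ofReal_re]) 0 0).norm
  refine h1.mono' (by fun_prop) (Filter.Eventually.of_forall fun x => ?_)
  rw [Real.norm_of_nonneg (Real.exp_pos _).le, Complex.norm_exp]
  refine Real.exp_le_exp.2 ?_
  have h2 : ‖x‖ ≤ ‖(T.symm : E →L[ℝ] E)‖ * ‖T x‖ := by
    simpa using (T.symm : E →L[ℝ] E).le_opNorm (T x)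
  have h3 : s / ‖(T.symm : E →L[ℝ] E)‖ ^ 2 * ‖x‖ ^ 2 ≤ s * ‖T x‖ ^ 2 := by
    rw [div_mul_eq_mul_div, div_le_iff₀ (by positivity), mul_assoc, ← mul_pow, mul_comm ‖T x‖]
    gcongr
  have h4 : (-((s / ‖(T.symm : E →L[ℝ] E)‖ ^ 2 : ℝ) : ℂ) * (‖x‖ : ℂ) ^ 2
      + 0 * ((inner ℝ 0 x : ℝ) : ℂ)).re = -(s / ‖(T.symm : E →L[ℝ] E)‖ ^ 2 * ‖x‖ ^ 2) := by
    rw [zero_mul, add_zero, ← Complex.ofReal_pow, ← Complex.ofReal_neg, ← Complex.ofReal_mul,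
      Complex.ofReal_re, neg_mul]
  rw [h4]
  linarith

theorem integrable_exp_inner_mul_exp_neg_mul_sq_norm_map (T : E ≃L[ℝ] E) {s : ℝ} (hs : 0 < s)
    (y : E) (τ : ℝ) :
    Integrable fun x => Real.exp (τ * inner ℝ (T x) y) * Real.exp (-s * ‖T x‖ ^ 2) := by
  simp_rw [exp_inner_mul_exp_neg_mul_sq_norm_map T hs]
  exact ((integrable_exp_neg_mul_sq_norm_map T hs).comp_sub_right _).const_mul _

theorem integral_exp_inner_mul_exp_neg_mul_sq_norm_map (T : E ≃L[ℝ] E) {s : ℝ} (hs : 0 < s)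
    (y : E) (τ : ℝ) :
    ∫ x, Real.exp (τ * inner ℝ (T x) y) * Real.exp (-s * ‖T x‖ ^ 2) =
      Real.exp (τ ^ 2 * ‖y‖ ^ 2 / (4 * s)) * ∫ x, Real.exp (-s * ‖T x‖ ^ 2) := by
  simp_rw [exp_inner_mul_exp_neg_mul_sq_norm_map T hs]
  rw [integral_const_mul, integral_sub_right_eq_self fun x => Real.exp (-s * ‖T x‖ ^ 2)]

/-- Hardy's uncertainty principle: if `ψ` is bounded by a Gaussian and its Fourier integral decays
along the line `ξ + t T* y` faster than the first bound allows, then it vanishes at `ξ`. -/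
theorem fourier_eq_zero_of_gaussian_bounds {ψ : E → ℂ} (hψm : AEStronglyMeasurable ψ)
    (T : E ≃L[ℝ] E) {s b C D : ℝ} (hs : 0 < s)
    (hψ : ∀ᵐ x, ‖ψ x‖ ≤ C * Real.exp (-s * ‖T x‖ ^ 2)) {y : E} (hy : y ≠ 0) (ξ : E)
    (hb : Real.pi ^ 2 * ‖y‖ ^ 2 / s < b)
    (hF : ∀ t : ℝ, ‖𝓕 ψ (ξ + t • ContinuousLinearMap.adjoint (T : E →L[ℝ] E) y)‖ ≤
      D * Real.exp (-b * t ^ 2)) : 𝓕 ψ ξ = 0 := by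
  have hy' : 0 < ‖y‖ := norm_pos_iff.2 hy
  have hπ := Real.pi_pos
  set h : E → ℂ := fun x => Real.fourierChar (-inner ℝ x ξ) • ψ x with hh
  have hnorm : ∀ x, ‖h x‖ = ‖ψ x‖ := fun x => by rw [hh, Circle.norm_smul]
  have hbound : ∀ τ : ℝ, ∀ᵐ x, ‖Real.exp (τ * inner ℝ (T x) y) * ‖h x‖‖ ≤
      C * (Real.exp (τ * inner ℝ (T x) y) * Real.exp (-s * ‖T x‖ ^ 2)) := fun τ => by
    filter_upwards [hψ] with x hx
    rw [norm_mul, norm_norm, Real.norm_of_nonneg (Real.exp_pos _).le, hnorm, mul_left_comm]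
    gcongr
  have hhm : AEStronglyMeasurable h := by
    have : Continuous fun x : E => Real.fourierChar (-inner ℝ x ξ) := by fun_prop
    exact this.aestronglyMeasurable.smul hψm
  have hlm : Continuous fun x => inner ℝ (T x) y := by fun_prop
  have hint : ∀ τ : ℝ, Integrable fun x => Real.exp (τ * inner ℝ (T x) y) * ‖h x‖ := fun τ =>
    ((integrable_exp_inner_mul_exp_neg_mul_sq_norm_map T hs y τ).const_mul C).mono'
      ((by fun_prop : Continuous fun x => Real.exp (τ * inner ℝ (T x) y)).aestronglyMeasurable.mul
        hhm.norm) (hbound τ)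
  have hdiff := differentiable_integral_cexp_mul hhm hlm.aestronglyMeasurable hint
  set g : ℂ → ℂ := fun z =>
    ∫ x, Complex.exp ((-2 * Real.pi * Complex.I * z) * (inner ℝ (T x) y : ℝ)) * h x with hg
  have hgd : Differentiable ℂ g :=
    hdiff.comp (by fun_prop : Differentiable ℂ fun z : ℂ => -2 * Real.pi * Complex.I * z)
  have hgreal : ∀ t : ℝ, g t = 𝓕 ψ (ξ + t • ContinuousLinearMap.adjoint (T : E →L[ℝ] E) y) := by
    intro t
    rw [Real.fourier_eq]
    refine integral_congr_ae (Filter.Eventually.of_forall fun x => ?_)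
    simp only [hh, Circle.smul_def, Real.fourierChar_apply, smul_eq_mul, ← mul_assoc,
      ← Complex.exp_add]
    congr 2
    rw [inner_add_right, inner_smul_right, ContinuousLinearMap.adjoint_inner_right]
    push_cast
    ring
  have hzero : g = 0 := by
    refine eq_zero_of_gaussian_bounds hgd (a := Real.pi ^ 2 * ‖y‖ ^ 2 / s)
      (C := C * ∫ x, Real.exp (-s * ‖T x‖ ^ 2)) (by positivity) hb ?_
      (fun t => by rw [hgreal]; exact hF t)
    intro z
    refine (norm_integral_le_integral_norm _).trans ?_
    have h1 := integral_mono_ae (hint (2 * Real.pi * z.im)).norm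
      ((integrable_exp_inner_mul_exp_neg_mul_sq_norm_map T hs y _).const_mul C) (hbound _)
    rw [integral_const_mul, integral_exp_inner_mul_exp_neg_mul_sq_norm_map T hs] at h1
    refine (le_of_eq ?_).trans (h1.trans_eq ?_)
    · refine integral_congr_ae (Filter.Eventually.of_forall fun x => ?_)
      simp only [norm_mul, Complex.norm_exp, norm_norm, Real.norm_of_nonneg (Real.exp_pos _).le]
      congr 2
      simp
    · have : (2 * Real.pi * z.im) ^ 2 * ‖y‖ ^ 2 / (4 * s) =
          Real.pi ^ 2 * ‖y‖ ^ 2 / s * z.im ^ 2 := by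
        field_simp
        ring
      rw [this]
      ring
  simpa using (hgreal 0).symm.trans (congrFun hzero _)

/-- Hardy's uncertainty principle for a nonzero square-integrable function that is bounded, like its
Fourier transform, by a Gaussian. -/
theorem norm_map_adjoint_le_of_gaussian_bounds {ψ : Lp (α := E) ℂ 2} (hψ0 : ψ ≠ 0)
    (T : E ≃L[ℝ] E) (U : E →L[ℝ] E) {s s' C D : ℝ} (hs : 0 < s) (hs' : 0 < s')
    (hψ : ∀ᵐ x, ‖ψ x‖ ≤ C * Real.exp (-s * ‖T x‖ ^ 2))
    (hF : ∀ᵐ ξ, ‖(𝓕 ψ : Lp (α := E) ℂ 2) ξ‖ ≤ D * Real.exp (-s' * ‖U ξ‖ ^ 2)) (y : E) :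
    s * s' * ‖U (ContinuousLinearMap.adjoint (T : E →L[ℝ] E) y)‖ ^ 2 ≤ Real.pi ^ 2 * ‖y‖ ^ 2 := by
  by_contra! hlt
  have hψm : AEStronglyMeasurable ψ := Lp.aestronglyMeasurable ψ
  have hψi : Integrable ψ := ((integrable_exp_neg_mul_sq_norm_map T hs).const_mul C).mono' hψm hψ
  have hae := Lp.fourier_ae_eq_fourierIntegral ψ hψi
  have hcont : Continuous (𝓕 (ψ : E → ℂ)) :=
    VectorFourier.fourierIntegral_continuous Real.continuous_fourierChar continuous_inner hψi
  -- The bound becomes pointwise since the set where it fails is open and null.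
  have hF' : ∀ ξ, ‖𝓕 (ψ : E → ℂ) ξ‖ ≤ D * Real.exp (-s' * ‖U ξ‖ ^ 2) := by
    have hopen : IsOpen {ξ | D * Real.exp (-s' * ‖U ξ‖ ^ 2) < ‖𝓕 (ψ : E → ℂ) ξ‖} :=
      isOpen_lt (by fun_prop) hcont.norm
    have hnull : volume {ξ | D * Real.exp (-s' * ‖U ξ‖ ^ 2) < ‖𝓕 (ψ : E → ℂ) ξ‖} = 0 := by
      rw [← nonpos_iff_eq_zero, ← ae_iff.1 (hae.and hF)]
      refine measure_mono fun ξ hξ h => ?_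
      exact absurd (h.1 ▸ h.2) (not_le.2 hξ.out)
    intro ξ
    exact not_lt.1 fun h => (hopen.eq_empty_of_measure_zero hnull).subset h
  have hy : y ≠ 0 := by rintro rfl; simp at hlt
  set v := ContinuousLinearMap.adjoint (T : E →L[ℝ] E) y
  have hD : 0 ≤ D := by simpa using (norm_nonneg _).trans (hF' 0)
  -- The gap above `b` leaves a quadratic term in `t` that absorbs the cross term of `‖U(ξ + tv)‖²`,
  -- at the cost of a constant depending on `ξ`.
  obtain ⟨b, hb1, hb2⟩ := exists_between
    (show Real.pi ^ 2 * ‖y‖ ^ 2 / s < s' * ‖U v‖ ^ 2 by rw [div_lt_iff₀ hs]; linarith)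
  have hzero : ∀ ξ, 𝓕 (ψ : E → ℂ) ξ = 0 := by
    intro ξ
    refine fourier_eq_zero_of_gaussian_bounds hψm T hs hψ hy ξ hb1
      (D := D * Real.exp ((s' * inner ℝ (U ξ) (U v)) ^ 2 / (s' * ‖U v‖ ^ 2 - b))) fun t => ?_
    refine (hF' _).trans ?_
    rw [mul_assoc, ← Real.exp_add]
    gcongr
    rw [map_add, map_smul, norm_add_sq_real, inner_smul_right, norm_smul, mul_pow,
      Real.norm_eq_abs, sq_abs]
    have hβ : 0 < s' * ‖U v‖ ^ 2 - b := by linarith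
    set κ := s' * inner ℝ (U ξ) (U v) with hκ
    have h1 : 0 ≤ (s' * ‖U v‖ ^ 2 - b) * t ^ 2 + 2 * t * κ + κ ^ 2 / (s' * ‖U v‖ ^ 2 - b) := by
      have : (s' * ‖U v‖ ^ 2 - b) * t ^ 2 + 2 * t * κ + κ ^ 2 / (s' * ‖U v‖ ^ 2 - b) =
          ((s' * ‖U v‖ ^ 2 - b) * t + κ) ^ 2 / (s' * ‖U v‖ ^ 2 - b) := by
        field_simp
        ring
      rw [this]
      positivity
    have h2 : 0 ≤ s' * ‖U ξ‖ ^ 2 := by positivity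
    linarith
  have h0 : 𝓕 ψ = 0 := by
    refine Lp.ext ?_
    filter_upwards [hae, Lp.coeFn_zero ℂ 2 (volume : Measure E)] with ξ h1 h2
    rw [h1, hzero, h2, Pi.zero_apply]
  exact hψ0 (norm_eq_zero.1 ((Lp.norm_fourier_eq ψ).symm.trans (h0 ▸ norm_zero)))

end Gaussian

/-! ### Symplectic geometry and the capacity bound -/

open scoped MatrixOrder in
/-- A positive definite quadratic form is the square of the norm in suitable coordinates. -/
theorem exists_quadForm_eq_sq_norm {n : ℕ} {M : Matrix (Fin n) (Fin n) ℝ} (hM : M.PosDef) :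
    ∃ T : ConfigSpace n ≃L[ℝ] ConfigSpace n, ∀ x, quadForm M x = ‖T x‖ ^ 2 := by
  obtain ⟨_, ⟨S, rfl⟩, rfl⟩ :=
    CStarAlgebra.isStrictlyPositive_iff_eq_star_mul_self.mp hM.isStrictlyPositive
  refine ⟨(LinearEquiv.ofBijective (Matrix.toEuclideanLin (S : Matrix (Fin n) (Fin n) ℝ))
    ?_).toContinuousLinearEquiv, fun x => ?_⟩
  · rw [Function.bijective_iff_has_inverse]
    refine ⟨Matrix.toEuclideanLin ((S⁻¹ : _) : Matrix (Fin n) (Fin n) ℝ), fun x => ?_, fun x => ?_⟩ <;>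
    simp [Matrix.toLpLin_apply]
  · change _ = ‖Matrix.toEuclideanLin (S : Matrix (Fin n) (Fin n) ℝ) x‖ ^ 2
    rw [EuclideanSpace.real_norm_sq_eq, quadForm, Matrix.star_eq_conjTranspose,
      ← Matrix.mulVec_mulVec, Matrix.dotProduct_mulVec, Matrix.conjTranspose_eq_transpose_of_trivial,
      Matrix.vecMul_transpose]
    simp [dotProduct, Matrix.toLpLin_apply, pow_two]

/-- The linear symplectomorphism `(x, p) ↦ (T⁻¹ x, T* p)`. -/
theorem exists_symplectomorphism_of_equiv {n : ℕ} (T : ConfigSpace n ≃L[ℝ] ConfigSpace n) :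
    ∃ f : OpenPartialHomeomorph (PhaseSpace n) (PhaseSpace n), IsSymplectomorphism f ∧
      f.source = Set.univ ∧ ∀ z, f z = (T.symm z.1,
        ContinuousLinearMap.adjoint (T : ConfigSpace n →L[ℝ] ConfigSpace n) z.2) := by
  set Tc : ConfigSpace n →L[ℝ] ConfigSpace n := (T : ConfigSpace n →L[ℝ] ConfigSpace n)
  set Ts : ConfigSpace n →L[ℝ] ConfigSpace n := (T.symm : ConfigSpace n →L[ℝ] ConfigSpace n)
  have h1 : Tc ∘L Ts = 1 := by ext1 x; simp [Tc, Ts]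
  have h2 : Ts ∘L Tc = 1 := by ext1 x; simp [Tc, Ts]
  have h1' := congrArg ContinuousLinearMap.adjoint h1
  have h2' := congrArg ContinuousLinearMap.adjoint h2
  rw [ContinuousLinearMap.adjoint_comp] at h1' h2'
  have hone : ContinuousLinearMap.adjoint (1 : ConfigSpace n →L[ℝ] ConfigSpace n) = 1 := by
    simp [← ContinuousLinearMap.star_eq_adjoint]
  rw [hone] at h1' h2'
  set Ta : ConfigSpace n ≃L[ℝ] ConfigSpace n := ContinuousLinearEquiv.equivOfInverse
    (ContinuousLinearMap.adjoint Tc) (ContinuousLinearMap.adjoint Ts)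
    (fun x => congrArg (fun L => L x) h1') (fun x => congrArg (fun L => L x) h2')
  set e : PhaseSpace n ≃L[ℝ] PhaseSpace n := T.symm.prodCongr Ta
  refine ⟨e.toHomeomorph.toOpenPartialHomeomorph,
    ⟨e.contDiff.contDiffOn, e.symm.contDiff.contDiffOn, ?_⟩, rfl, fun z => rfl⟩
  intro z _ v w
  have h3 : fderiv ℝ (e.toHomeomorph.toOpenPartialHomeomorph) z = e := e.fderiv
  have h4 : ∀ p x, inner ℝ (ContinuousLinearMap.adjoint Tc p) (T.symm x) = inner ℝ p x := fun p x => by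
    rw [ContinuousLinearMap.adjoint_inner_left]; simp [Tc]
  rw [h3]
  change inner ℝ (ContinuousLinearMap.adjoint Tc v.2) (T.symm w.1) -
    inner ℝ (ContinuousLinearMap.adjoint Tc w.2) (T.symm v.1) = _
  rw [h4, h4]
  rfl

/-- A Gaussian bound on the `ħ`-dependent Fourier transform, expressed for the unitary one. -/
theorem ae_norm_fourier_le_of_hbarFourier {n : ℕ} {ħ : ℝ} (hħ : 0 < ħ)
    {ψ : Lp (α := ConfigSpace n) ℂ 2} {U : ConfigSpace n →L[ℝ] ConfigSpace n} {C : ℝ}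
    (h : ∀ᵐ p, ‖hbarFourier ħ ψ p‖ ≤ C * Real.exp (-(1 / (2 * ħ)) * ‖U p‖ ^ 2)) :
    ∀ᵐ ξ, ‖(𝓕 ψ : Lp (α := ConfigSpace n) ℂ 2) ξ‖ ≤
      C / (1 / (2 * Real.pi * ħ)) ^ ((n : ℝ) / 2) *
        Real.exp (-(2 * Real.pi ^ 2 * ħ) * ‖U ξ‖ ^ 2) := by
  have hπ := Real.pi_pos
  have ha : 2 * Real.pi * ħ ≠ 0 := by positivity
  have hq : Measure.QuasiMeasurePreserving
      (fun ξ : ConfigSpace n => (2 * Real.pi * ħ) • ξ) volume volume :=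
    ⟨by fun_prop, by
      rw [Measure.map_addHaar_smul volume ha]
      exact Measure.smul_absolutelyContinuous⟩
  filter_upwards [hq.ae h] with ξ hξ
  have hk : 0 < (1 / (2 * Real.pi * ħ)) ^ ((n : ℝ) / 2) := by positivity
  rw [hbarFourier, smul_smul, one_div_mul_cancel ha, one_smul, norm_mul, Complex.norm_real,
    Real.norm_of_nonneg hk.le, map_smul, norm_smul, mul_pow, Real.norm_eq_abs, sq_abs] at hξ
  rw [div_mul_eq_mul_div, le_div_iff₀ hk, mul_comm]
  refine hξ.trans_eq ?_
  congr 2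
  field_simp

theorem proposition2 (n : ℕ) (ħ h : ℝ) (hħ : 0 < ħ) (hh : h = 2 * Real.pi * ħ)
    (A B : Matrix (Fin n) (Fin n) ℝ) (hA : A.PosDef) (hB : B.PosDef)
    (ψ : Lp (α := ConfigSpace n) ℂ 2) (hψ : ψ ≠ 0)
    (CA CB : ℝ)
    (hψA : ∀ᵐ x : ConfigSpace n, ‖ψ x‖ ≤ CA * Real.exp (-(1 / (2 * ħ)) * quadForm A x))
    (hψB : ∀ᵐ p : ConfigSpace n,
      ‖hbarFourier ħ ψ p‖ ≤ CB * Real.exp (-(1 / (2 * ħ)) * quadForm B p))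
    (c : Set (PhaseSpace n) → ℝ≥0∞) (hc : IsSymplecticCapacity c) :
    ENNReal.ofReal (h / 2) ≤ c (wignerEllipsoid ħ A B) := by
  have hπ := Real.pi_pos
  obtain ⟨T, hT⟩ := exists_quadForm_eq_sq_norm hA
  obtain ⟨U, hU⟩ := exists_quadForm_eq_sq_norm hB
  simp_rw [hT] at hψA
  simp_rw [hU] at hψB
  have hle : ∀ p, ‖U (ContinuousLinearMap.adjoint (T : ConfigSpace n →L[ℝ] ConfigSpace n) p)‖ ^ 2
      ≤ ‖p‖ ^ 2 := fun p => by
    have := norm_map_adjoint_le_of_gaussian_bounds hψ T (U : ConfigSpace n →L[ℝ] ConfigSpace n)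
      (by positivity) (by positivity) hψA
      (ae_norm_fourier_le_of_hbarFourier hħ (U := (U : ConfigSpace n →L[ℝ] ConfigSpace n)) hψB) p
    -- The two decay rates multiply to exactly `π²`, so `ħ` drops out of Hardy's inequality.
    rw [show 1 / (2 * ħ) * (2 * Real.pi ^ 2 * ħ) = Real.pi ^ 2 by field_simp] at this
    exact le_of_mul_le_mul_left this (by positivity)
  obtain ⟨f, hf, hsource, hfz⟩ := exists_symplectomorphism_of_equiv T
  calc ENNReal.ofReal (h / 2) = c (phaseBall n √ħ) := by
        rw [hc.ball _ (Real.sqrt_pos.2 hħ), Real.sq_sqrt hħ.le, hh]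
        ring_nf
    _ = c (f '' phaseBall n √ħ) := (hc.invariant _ f hf (by simp [hsource])).symm
    _ ≤ c (wignerEllipsoid ħ A B) := by
        refine hc.mono _ _ ?_
        rintro _ ⟨z, hz, rfl⟩
        rw [phaseBall, Set.mem_ofPred_eq, Real.sq_sqrt hħ.le] at hz
        rw [wignerEllipsoid, Set.mem_ofPred_eq, hfz, hT, hU, T.apply_symm_apply]
        exact (add_le_add_right (hle z.2) _).trans hz
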